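/- Let $\langle\mathcal C,\mathcal M\rangle$ be an $\mathcal M$-adhesive category ($\mathcal M$ is a class of monomorphisms containing all isomorphisms and closed under composition and decomposition; pushouts and pullbacks along $\mathcal M$-morphisms exist and preserve $\mathcal M$; pushouts along $\mathcal M$-morphisms are van Kampen for commutative cubes with vertical morphisms in $\mathcal M$) with binary coproducts and a unique $\mathcal E'$-$\mathcal M$ pair factorization: each pair of morphisms with common codomain factors, uniquely up to isomorphism, as a pair in $\mathcal E'$ followed by a morphism of $\mathcal M$. *Conditions.* Application conditions (ACs) over an object $P$ are built by $\exists(a\colon P\to Q,\,c)$ ($c$ an AC over $Q$), $\neg$ and (arbitrary set-indexed) $\bigwedge$; $p\colon P\to G$ satisfies $\exists(a,c)$ iff $p=q\circ a$ for some $q\in\mathcal M$ satisfying $c$. $\exists a$ means $\exists(a,\mathrm{true})$. Two ACs are equivalent if the same morphisms satisfy them. $\mathrm{Shift}(b,\cdot)$ commutes with $\neg,\bigwedge$ and $\mathrm{Shift}(b,\exists(a,c))=\bigvee\exists(a',\mathrm{Shift}(b',c))$ over all $(a',b')\in\mathcal E'$ with $b'\in\mathcal M$, $b'a=a'b$. For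 a span $L\leftarrow I\to R$ in $\mathcal M$, $\mathrm{Left}$ turns ACs over $R$ into ACs over $L$; it commutes with $\neg,\bigwedge$, and sends $\exists(a\colon R\to X,c)$ to $\exists(b\colon L\to Y,\mathrm{Left}(Y\leftarrow Z\to X,c))$, where $Z$ is the pushout complement of $I\to R\to X$ and $Y$ the pushout of $L\leftarrow I\to Z$ (to false if there is no pushout complement). *Transformations.* A plain rule is a span $p=(L\leftarrow I\to R)$ in $\mathcal M$; a rule $\rho=\langle p,\mathrm{ac}_L\rangle$ adds an AC over $L$. A plain direct transformation $G\Rightarrow H$ via $p$ with match $o\colon L\to G$ consists of two pushouts, along $I\to D$, with derived span $G\xleftarrow{k}D\xrightarrow{c}H$. A pair of plain transformations $H_1\Leftarrow G\Rightarrow H_2$ via $p_1,p_2$ is a transformation pair for $\langle\rho_1,\rho_2\rangle$ if its matches satisfy the rules' ACs. It is parallel independent if there are $d_{12}\colon L_1\to D_2$, $d_{21}\colon L_2\to D_1$ with $k_2d_{12}=o_1$, $k_1d_{21}=o_2$ such that $c_2d_{12}$ and $c_1d_{21}$ satisfy $\mathrm{ac}_{L_1}$ and $\mathrm{ac}_{L_2}$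 (for plain pairs the last condition is dropped); otherwise it is parallel dependent, or a conflict. A pair on $K$ embeds into a pair on $G$ via $m\colon K\to G$ if there are extension diagrams over $m$: compatible morphisms between the two double-pushout diagrams such that the squares between the derived spans are pushouts. A plain pair $tp^I$ is initial for a plain pair $tp$ if it embeds into $tp$ via some $f^I$ and, for each pair $tp'$ embedded into $tp$ via some $f$, it embeds by unique extension diagrams into $tp'$ via an $f'$ with $f\circ f'=f^I$. A set $\mathcal T$ of transformation pairs is $\mathcal M$-complete w.r.t. parallel dependence if into each conflict for $\langle\rho_1,\rho_2\rangle$ some element of $\mathcal T$ embeds via an $m\in\mathcal M$. *Initial conflicts.* A plain pair $tp_K$ on $K$ with matches $o_1,o_2$ determines a symbolic transformation pair $\langle tp_K,\mathrm{ac}_K,\mathrm{ac}^*_K\rangle$ with $\mathrm{ac}_K=\mathrm{Shift}(o_1,\mathrm{ac}_{L_1})\wedge\mathrm{Shift}(o_2,\mathrm{ac}_{L_2})$ and $\mathrm{ac}^*_K=\neg(\alpha_{12}\wedge\alpha_{21})$, where $\alpha_{12}=\mathrm{Left}(K\xleftarrow{k_2}D_2\xrightarrow{c_2}P_2,\ \mathrm{Shift}(c_2d_{12},\mathrm{ac}_{L_1}))$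 if some $d_{12}$ with $k_2d_{12}=o_1$ exists and $\alpha_{12}=\mathrm{false}$ otherwise, and $\alpha_{21}$ symmetrically. It is an initial conflict for $\langle\rho_1,\rho_2\rangle$ if $tp_K$ embeds into some conflict for $\langle\rho_1,\rho_2\rangle$, and $tp_K$ either is plainly in conflict and isomorphic to an initial pair for itself, or is isomorphic to $R_1+L_2\Leftarrow L_1+L_2\Rightarrow L_1+R_2$ with the coproduct injections as matches. A regular form of it is a condition $\bigvee_{i\in I}\exists(a_i\colon K\to C_i,\ \bigwedge_{j\in J_i}\neg\exists(b_{ij},d_{ij}))$ equivalent to $\mathrm{ac}_K\wedge\mathrm{ac}^*_K$, with $I\neq\emptyset$ and no $b_{ij}$ an isomorphism. The corresponding disjunctive unfolding consists of the pairs $D_{1,i}\Leftarrow C_i\Rightarrow D_{2,i}$ with matches $a_io_1,a_io_2$, for those $i$ for which $tp_K$ embeds via $a_i$. **Claim.** Let $\mathcal R$ be a set of rules such that, for any two rules of $\mathcal R$, each plain pair in conflict has an initial pair. Let $\rho_1,\rho_2\in\mathcal R$ with $\mathrm{ac}_{L_i}=\bigwedge_{j\in J_i}\neg\exists(n_{i,j}\colon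 L_i\to N_{i,j})$, $J_i$ finite ($i=1,2$). Then: 1. Every initial conflict for $\langle\rho_1,\rho_2\rangle$ has a regular form in which all $d_{ij}$ are true. Moreover, let $\mathcal F$ be a class of objects closed under $\mathcal M$-subobjects such that any two $A,B\in\mathcal F$ are the domains of only finitely many pairs of $\mathcal E'$ up to isomorphism, each with codomain in $\mathcal F$. If all $L_i,R_i,N_{i,j}$ are in $\mathcal F$, the regular form can be chosen with finite index sets. 2. For every choice of a regular form for each initial conflict, the union of the disjunctive unfoldings of all initial conflicts consists of conflicts for $\langle\rho_1,\rho_2\rangle$ and is $\mathcal M$-complete w.r.t. parallel dependence. -/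

import Mathlib

open CategoryTheory CategoryTheory.Limits

universe v u

namespace MAdh

section Categories

variable {C : Type u} [Category.{v} C]

/-- `⟨C, M⟩` is an `M`-adhesive category: `M` is a class of monomorphisms containing all
isomorphisms and closed under composition and decomposition, pushouts and pullbacks along
`M`-morphisms exist, `M` is stable under them, and pushouts along `M`-morphisms are
`M`-van Kampen squares (van Kampen for cubes whose vertical morphisms are in `M`). -/
structure IsMAdhesive (M : MorphismProperty C) : Prop where
  mono : ∀ {X Y : C} (f : X ⟶ Y), M f → Mono f
  of_isIso : ∀ {X Y : C} (f : X ⟶ Y), IsIso f → M f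
  comp : ∀ {X Y Z : C} (f : X ⟶ Y) (g : Y ⟶ Z), M f → M g → M (f ≫ g)
  decomp : ∀ {X Y Z : C} (f : X ⟶ Y) (g : Y ⟶ Z), M (f ≫ g) → M g → M f
  hasPushout : ∀ {W X Y : C} (f : W ⟶ X) (g : W ⟶ Y), M f → HasPushout f g
  hasPullback : ∀ {X Y Z : C} (h : X ⟶ Z) (i : Y ⟶ Z), M h → HasPullback h i
  pushout_mem : ∀ {W X Y Z : C} {f : W ⟶ X} {g : W ⟶ Y} {h : X ⟶ Z} {i : Y ⟶ Z},
    IsPushout f g h i → M f → M i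
  pullback_mem : ∀ {W X Y Z : C} {f : W ⟶ X} {g : W ⟶ Y} {h : X ⟶ Z} {i : Y ⟶ Z},
    IsPullback f g h i → M h → M g
  vanKampen : ∀ {W X Y Z : C} {f : W ⟶ X} {g : W ⟶ Y} {h : X ⟶ Z} {i : Y ⟶ Z},
    IsPushout f g h i → M f →
    ∀ {W' X' Y' Z' : C} (f' : W' ⟶ X') (g' : W' ⟶ Y') (h' : X' ⟶ Z') (i' : Y' ⟶ Z')
      (αW : W' ⟶ W) (αX : X' ⟶ X) (αY : Y' ⟶ Y) (αZ : Z' ⟶ Z),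
      M αX → M αY → M αZ →
      IsPullback f' αW αX f → IsPullback g' αW αY g →
      CommSq h' αX αZ h → CommSq i' αY αZ i → CommSq f' g' h' i' →
      (IsPushout f' g' h' i' ↔ IsPullback h' αX αZ h ∧ IsPullback i' αY αZ i)

variable (C) in
/-- A class of pairs of morphisms with the same codomain. -/
abbrev PairClass : Type (max u v) :=
  ∀ ⦃A B X : C⦄, (A ⟶ X) → (B ⟶ X) → Prop

/-- Every pair of morphisms with the same codomain factors as a pair in `E` followed by a morphism
in `M`, and this factorization is unique up to isomorphism. -/
structure HasUniquePairFactorization (E : PairClass C) (M : MorphismProperty C) : Prop where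
  exists_fac : ∀ {A B X : C} (f : A ⟶ X) (g : B ⟶ X),
    ∃ (K : C) (e₁ : A ⟶ K) (e₂ : B ⟶ K) (m : K ⟶ X),
      E e₁ e₂ ∧ M m ∧ e₁ ≫ m = f ∧ e₂ ≫ m = g
  unique_fac : ∀ {A B X K K' : C} (e₁ : A ⟶ K) (e₂ : B ⟶ K) (m : K ⟶ X)
    (e₁' : A ⟶ K') (e₂' : B ⟶ K') (m' : K' ⟶ X),
    E e₁ e₂ → M m → E e₁' e₂' → M m' → e₁ ≫ m = e₁' ≫ m' → e₂ ≫ m = e₂' ≫ m' →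
    ∃ φ : K ≅ K', e₁ ≫ φ.hom = e₁' ∧ e₂ ≫ φ.hom = e₂' ∧ φ.hom ≫ m' = m

/-- `F` behaves like a class of finite objects: it is closed under `M`-subobjects, and two objects
of `F` are the domains of only finitely many pairs of `E` up to isomorphism, with codomain
in `F`. (Example: finite graphs among all graphs, jointly surjective pairs.) -/
structure IsFinitaryClass (E : PairClass C) (M : MorphismProperty C) (F : C → Prop) : Prop where
  of_mem : ∀ {A B : C} (m : A ⟶ B), M m → F B → F A
  finite_pairs : ∀ A B : C, F A → F B →
    ∃ (n : ℕ) (X : Fin n → C) (e₁ : ∀ i, A ⟶ X i) (e₂ : ∀ i, B ⟶ X i),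
      (∀ i, F (X i)) ∧
      ∀ (Y : C) (f₁ : A ⟶ Y) (f₂ : B ⟶ Y), E f₁ f₂ →
        ∃ (i : Fin n) (φ : X i ≅ Y), e₁ i ≫ φ.hom = f₁ ∧ e₂ i ≫ φ.hom = f₂

end Categories

/-! ### Application conditions -/

/-- Nested application conditions over the objects of `C`. Index sets are arbitrary (small)
sets; finiteness is stated separately where it matters. -/
inductive AppCond {C : Type u} [Category.{v} C] : C → Type (max (u + 1) (v + 1))
  | ex {P Q : C} (a : P ⟶ Q) (c : AppCond Q) : AppCond P
  | neg {P : C} (c : AppCond P) : AppCond P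
  | conj {P : C} (J : Type (max u v)) (c : J → AppCond P) : AppCond P

namespace AppCond

variable {C : Type u} [Category.{v} C]

/-- The condition `true`: the empty conjunction. -/
def truth {P : C} : AppCond P := conj PEmpty (fun j => j.elim)

/-- The condition `false`. -/
def falsity {P : C} : AppCond P := neg truth

/-- Binary conjunction. -/
def and {P : C} (c d : AppCond P) : AppCond P :=
  conj (ULift Bool) (fun b => cond b.down c d)

/-- Disjunction over an index set. -/
def disj {P : C} (J : Type (max u v)) (c : J → AppCond P) : AppCond P :=
  neg (conj J (fun j => neg (c j)))

/-- `⋀ j, ¬ ∃ (n j)`: a conjunction of negative application conditions. -/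
def nacs {P : C} {J : Type (max u v)} {N : J → C} (n : ∀ j, P ⟶ N j) : AppCond P :=
  conj J (fun j => neg (ex (n j) truth))

/-- `c.Sat M p`: the morphism `p` satisfies the application condition `c`. -/
def Sat (M : MorphismProperty C) : ∀ {P : C}, AppCond P → ∀ {G : C}, (P ⟶ G) → Prop
  | _, ex a c, _, p => ∃ q, M q ∧ a ≫ q = p ∧ c.Sat M q
  | _, neg c, _, p => ¬ c.Sat M p
  | _, conj _ c, _, p => ∀ j, (c j).Sat M p

/-- Equivalence of application conditions over the same object. -/
def Equiv (M : MorphismProperty C) {P : C} (c d : AppCond P) : Prop :=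
  ∀ (G : C) (p : P ⟶ G), c.Sat M p ↔ d.Sat M p

/-- The index set for shifting `∃ (a, c)` along `b`: commuting squares `a ≫ b' = b ≫ a'` with
`(a', b')` in `E` and `b'` in `M`. -/
structure ShiftIndex (E : PairClass C) (M : MorphismProperty C) {P Q P' : C}
    (a : P ⟶ Q) (b : P ⟶ P') where
  X : C
  a' : P' ⟶ X
  b' : Q ⟶ X
  mem_pair : E a' b'
  mem : M b'
  comm : a ≫ b' = b ≫ a'

/-- `Shift(b, c)`: shift of an application condition along a morphism. -/
def shift (E : PairClass C) (M : MorphismProperty C) :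
    ∀ {P : C}, AppCond P → ∀ {P' : C}, (P ⟶ P') → AppCond P'
  | _, ex a c, _, b =>
      disj (ShiftIndex E M a b) (fun x => ex x.a' (c.shift E M x.b'))
  | _, neg c, _, b => neg (c.shift E M b)
  | _, conj J c, _, b => conj J (fun j => (c j).shift E M b)

/-- For a span `L ←l- I -r→ R` and `a : R ⟶ X`: a pushout complement `Z` of `r` and `a` together
with the pushout `Y` of `l` along `I ⟶ Z`. -/
structure LeftStep {L I R X : C} (l : I ⟶ L) (r : I ⟶ R) (a : R ⟶ X) where
  Z : C
  Y : C
  z : I ⟶ Z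
  r' : Z ⟶ X
  b : L ⟶ Y
  l' : Z ⟶ Y
  right_po : IsPushout r z a r'
  left_po : IsPushout l z b l'

open Classical in
/-- `Left(L ←l- I -r→ R, c)`: shift of an application condition on `R` over a plain rule to `L`.
The condition `∃ (a, c)` becomes `∃ (b, Left(Y ← Z → X, c))` for the rule `Y ← Z → X` derived by
applying the inverse rule at `a`, and `false` if this is impossible. -/
noncomputable def left : ∀ {R : C}, AppCond R → ∀ {L I : C}, (I ⟶ L) → (I ⟶ R) → AppCond L
  | _, ex a c, _, _, l, r =>
      if h : Nonempty (LeftStep l r a) then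
        ex h.some.b (c.left h.some.l' h.some.r')
      else falsity
  | _, neg c, _, _, l, r => neg (c.left l r)
  | _, conj J c, _, _, l, r => conj J (fun j => (c j).left l r)

end AppCond

/-! ### Rules and transformations -/

/-- A plain rule `L ←l- I -r→ R` with both morphisms in `M`. -/
structure PlainRule {C : Type u} [Category.{v} C] (M : MorphismProperty C) where
  L : C
  I : C
  R : C
  l : I ⟶ L
  r : I ⟶ R
  l_mem : M l
  r_mem : M r

/-- A rule: a plain rule with an application condition over its left-hand side. -/
structure Rule {C : Type u} [Category.{v} C] (M : MorphismProperty C) extends PlainRule M where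
  ac : AppCond L

variable {C : Type u} [Category.{v} C] {M : MorphismProperty C}

/-- An AC-disregarding (i.e. plain) direct transformation `G ⇒ H` via `p`, with match `o`,
comatch `o'` and derived span `G ←k- D -c→ H`. -/
structure DirectTransformation (p : PlainRule M) (G : C) where
  D : C
  H : C
  o : p.L ⟶ G
  u : p.I ⟶ D
  o' : p.R ⟶ H
  k : D ⟶ G
  c : D ⟶ H
  left_po : IsPushout p.l u o k
  right_po : IsPushout p.r u o' c

/-- An extension diagram over the extension morphism `f`: both squares between the derived spans
are pushouts, and they are compatible with the two applications of the rule. -/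
structure Extension {p : PlainRule M} {G G' : C} (f : G ⟶ G')
    (t : DirectTransformation p G) (t' : DirectTransformation p G') where
  d : t.D ⟶ t'.D
  h : t.H ⟶ t'.H
  o_comp : t.o ≫ f = t'.o
  u_comp : t.u ≫ d = t'.u
  o'_comp : t.o' ≫ h = t'.o'
  left_po : IsPushout t.k d f t'.k
  right_po : IsPushout t.c d h t'.c

/-- A pair `H₁ ⇐ G ⇒ H₂` of AC-disregarding direct transformations via `p₁` and `p₂`. -/
structure TransformationPair (p₁ p₂ : PlainRule M) (G : C) where
  fst : DirectTransformation p₁ G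
  snd : DirectTransformation p₂ G

/-- Extension diagrams for both transformations of a pair over one extension morphism `f`. -/
structure PairExtension {p₁ p₂ : PlainRule M} {G G' : C} (f : G ⟶ G')
    (tp : TransformationPair p₁ p₂ G) (tp' : TransformationPair p₁ p₂ G') where
  fst : Extension f tp.fst tp'.fst
  snd : Extension f tp.snd tp'.snd

/-- Parallel independence of a pair of plain transformations. -/
def TransformationPair.PlainIndependent {p₁ p₂ : PlainRule M} {G : C}
    (tp : TransformationPair p₁ p₂ G) : Prop :=
  (∃ d₁₂ : p₁.L ⟶ tp.snd.D, d₁₂ ≫ tp.snd.k = tp.fst.o) ∧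
  (∃ d₂₁ : p₂.L ⟶ tp.fst.D, d₂₁ ≫ tp.fst.k = tp.snd.o)

/-- Isomorphism of pairs of plain transformations. -/
def TransformationPair.Isomorphic {p₁ p₂ : PlainRule M} {G G' : C}
    (tp : TransformationPair p₁ p₂ G) (tp' : TransformationPair p₁ p₂ G') : Prop :=
  ∃ (f : G ⟶ G') (e : PairExtension f tp tp'),
    IsIso f ∧ IsIso e.fst.d ∧ IsIso e.fst.h ∧ IsIso e.snd.d ∧ IsIso e.snd.h

/-- `tpI` is an initial transformation pair for `tp`: it embeds into `tp` and, compatibly and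
uniquely, into every pair that embeds into `tp`. -/
def TransformationPair.IsInitialFor {p₁ p₂ : PlainRule M} {GI G : C}
    (tpI : TransformationPair p₁ p₂ GI) (tp : TransformationPair p₁ p₂ G) : Prop :=
  ∃ fI : GI ⟶ G, Nonempty (PairExtension fI tpI tp) ∧
    ∀ (G' : C) (tp' : TransformationPair p₁ p₂ G') (f : G' ⟶ G),
      Nonempty (PairExtension f tp' tp) →
        ∃! e : (Σ g : GI ⟶ G', PairExtension g tpI tp'), e.1 ≫ f = fI

/-- The system with rule set `𝓡` has initial transformation pairs for conflicts along plain
rules. -/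
def HasInitialPairsForConflicts (𝓡 : Set (Rule M)) : Prop :=
  ∀ ρ₁ ∈ 𝓡, ∀ ρ₂ ∈ 𝓡, ∀ (G : C)
    (tp : TransformationPair ρ₁.toPlainRule ρ₂.toPlainRule G), ¬ tp.PlainIndependent →
      ∃ (GI : C) (tpI : TransformationPair ρ₁.toPlainRule ρ₂.toPlainRule GI),
        tpI.IsInitialFor tp

/-- `tp` is an initial conflict for the plain rules. -/
def TransformationPair.IsPlainInitialConflict {p₁ p₂ : PlainRule M} {G : C}
    (tp : TransformationPair p₁ p₂ G) : Prop :=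
  ¬ tp.PlainIndependent ∧
    ∃ (GI : C) (tpI : TransformationPair p₁ p₂ GI), tpI.IsInitialFor tp ∧ tp.Isomorphic tpI

lemma isPushout_coprod_inr_with_id [HasBinaryCoproducts C] {A B : C} (f : A ⟶ B) (X : C) :
    IsPushout (coprod.inr : A ⟶ X ⨿ A) f (coprod.map (𝟙 X) f) coprod.inr where
  w := by simp
  isColimit' := ⟨PushoutCocone.IsColimit.mk _
    (fun s ↦ coprod.desc (coprod.inl ≫ s.inl) s.inr)
    (fun s ↦ by
      apply coprod.hom_ext
      · rw [coprod.inl_map_assoc, Category.id_comp, coprod.inl_desc]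
      · rw [coprod.inr_map_assoc, coprod.inr_desc, PushoutCocone.condition])
    (fun s ↦ coprod.inr_desc _ _)
    (fun s m h₁ h₂ ↦ by
      apply coprod.hom_ext
      · rw [coprod.inl_desc, ← h₁, coprod.inl_map_assoc, Category.id_comp]
      · rw [coprod.inr_desc, h₂])⟩

/-- The pair `R₁ + L₂ ⇐ L₁ + L₂ ⇒ L₁ + R₂` whose matches are the coproduct injections. -/
noncomputable def coproductPair [HasBinaryCoproducts C] (p₁ p₂ : PlainRule M) :
    TransformationPair p₁ p₂ (p₁.L ⨿ p₂.L) where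
  fst :=
    { D := p₁.I ⨿ p₂.L
      H := p₁.R ⨿ p₂.L
      o := coprod.inl
      u := coprod.inl
      o' := coprod.inl
      k := coprod.map p₁.l (𝟙 _)
      c := coprod.map p₁.r (𝟙 _)
      left_po := (IsPushout.of_coprod_inl_with_id p₁.l p₂.L).flip
      right_po := (IsPushout.of_coprod_inl_with_id p₁.r p₂.L).flip }
  snd :=
    { D := p₁.L ⨿ p₂.I
      H := p₁.L ⨿ p₂.R
      o := coprod.inr
      u := coprod.inr
      o' := coprod.inr
      k := coprod.map (𝟙 _) p₂.l
      c := coprod.map (𝟙 _) p₂.r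
      left_po := (isPushout_coprod_inr_with_id p₂.l p₁.L).flip
      right_po := (isPushout_coprod_inr_with_id p₂.r p₁.L).flip }

/-- `tp` is the initial parallel independent transformation pair (up to isomorphism). -/
def TransformationPair.IsInitialParallelIndependent [HasBinaryCoproducts C]
    {p₁ p₂ : PlainRule M} {G : C} (tp : TransformationPair p₁ p₂ G) : Prop :=
  tp.PlainIndependent ∧ tp.Isomorphic (coproductPair p₁ p₂)

/-! ### Pairs for rules with application conditions -/

/-- AC-disregarding transformation pairs for a pair of rules, on varying objects. -/
abbrev PairFor (ρ₁ ρ₂ : Rule M) : Type (max u v) :=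
  Σ G : C, TransformationPair ρ₁.toPlainRule ρ₂.toPlainRule G

namespace PairFor

variable {ρ₁ ρ₂ : Rule M}

/-- Both matches satisfy the application conditions, i.e. `x` is a transformation pair for the
rules with application conditions. -/
def SatisfiesACs (x : PairFor ρ₁ ρ₂) : Prop :=
  ρ₁.ac.Sat M x.2.fst.o ∧ ρ₂.ac.Sat M x.2.snd.o

/-- Parallel independence for rules with application conditions. -/
def ParallelIndependent (x : PairFor ρ₁ ρ₂) : Prop :=
  (∃ d₁₂ : ρ₁.L ⟶ x.2.snd.D, d₁₂ ≫ x.2.snd.k = x.2.fst.o ∧ ρ₁.ac.Sat M (d₁₂ ≫ x.2.snd.c)) ∧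
  (∃ d₂₁ : ρ₂.L ⟶ x.2.fst.D, d₂₁ ≫ x.2.fst.k = x.2.snd.o ∧ ρ₂.ac.Sat M (d₂₁ ≫ x.2.fst.c))

/-- `x` is a conflict: a transformation pair for `⟨ρ₁, ρ₂⟩` that is parallel dependent. -/
def IsConflict (x : PairFor ρ₁ ρ₂) : Prop :=
  x.SatisfiesACs ∧ ¬ x.ParallelIndependent

/-- `M`-completeness w.r.t. parallel dependence of a set of transformation pairs. -/
def MComplete (S : Set (PairFor ρ₁ ρ₂)) : Prop :=
  ∀ y : PairFor ρ₁ ρ₂, y.IsConflict →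
    ∃ x ∈ S, ∃ m : x.1 ⟶ y.1, M m ∧ Nonempty (PairExtension m x.2 y.2)

/-! A symbolic transformation pair consists of an AC-disregarding pair `x` on an object `K` and the
two application conditions `x.extAC` and `x.conflictAC` on `K`, which are determined by `x`. -/

/-- The extension AC `ac_K = Shift(o₁, ac₁) ∧ Shift(o₂, ac₂)`. -/
def extAC (E : PairClass C) (x : PairFor ρ₁ ρ₂) : AppCond x.1 :=
  (ρ₁.ac.shift E M x.2.fst.o).and (ρ₂.ac.shift E M x.2.snd.o)

open Classical in
/-- The conflict-inducing AC `ac*_K`. -/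
noncomputable def conflictAC (E : PairClass C) (x : PairFor ρ₁ ρ₂) : AppCond x.1 :=
  AppCond.neg (AppCond.and
    (if h : ∃ d₁₂ : ρ₁.L ⟶ x.2.snd.D, d₁₂ ≫ x.2.snd.k = x.2.fst.o then
      (ρ₁.ac.shift E M (h.choose ≫ x.2.snd.c)).left x.2.snd.k x.2.snd.c
    else AppCond.falsity)
    (if h : ∃ d₂₁ : ρ₂.L ⟶ x.2.fst.D, d₂₁ ≫ x.2.fst.k = x.2.snd.o then
      (ρ₂.ac.shift E M (h.choose ≫ x.2.fst.c)).left x.2.fst.k x.2.fst.c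
    else AppCond.falsity))

/-- The unfolding of the symbolic pair of `x`: all transformation pairs (with application
conditions satisfied) into which `x` embeds. -/
def unfolding (x : PairFor ρ₁ ρ₂) : Set (PairFor ρ₁ ρ₂) :=
  {y | y.SatisfiesACs ∧ ∃ m : x.1 ⟶ y.1, Nonempty (PairExtension m x.2 y.2)}

/-- The symbolic pair of `x` is conflict-inducing. -/
def ConflictInducing (x : PairFor ρ₁ ρ₂) : Prop :=
  ∃ y ∈ x.unfolding, y.IsConflict

/-- The symbolic pair of `x` is an initial conflict for `⟨ρ₁, ρ₂⟩`. -/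
def IsInitialConflict [HasBinaryCoproducts C] (x : PairFor ρ₁ ρ₂) : Prop :=
  x.ConflictInducing ∧ (x.2.IsPlainInitialConflict ∨ x.2.IsInitialParallelIndependent)

/-- A regular form of the symbolic pair of `x`: a condition `⋁ i, ∃ (a i, ⋀ j, ¬ ∃ (b i j, d i j))`
equivalent to `ac_K ∧ ac*_K`, with non-empty index set `I` and no `b i j` an isomorphism. -/
structure RegularForm (E : PairClass C) (x : PairFor ρ₁ ρ₂) where
  I : Type (max u v)
  nonempty : Nonempty I
  obj : I → C
  a : ∀ i, x.1 ⟶ obj i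
  J : I → Type (max u v)
  tgt : ∀ i, J i → C
  b : ∀ i j, obj i ⟶ tgt i j
  d : ∀ i j, AppCond (tgt i j)
  not_isIso : ∀ i j, ¬ IsIso (b i j)
  equiv : AppCond.Equiv M ((x.extAC E).and (x.conflictAC E))
    (AppCond.disj I (fun i => AppCond.ex (a i)
      (AppCond.conj (J i) (fun j => AppCond.neg (AppCond.ex (b i j) (d i j))))))

namespace RegularForm

variable {E : PairClass C} {x : PairFor ρ₁ ρ₂}

/-- All negative remainders are conjunctions of plain NACs `¬ ∃ (b i j)`. -/
def OnlyNACs (N : RegularForm E x) : Prop :=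
  ∀ i j, N.d i j = AppCond.truth

/-- The disjunction and all its negative remainders have finite index sets. -/
def IsFinite (N : RegularForm E x) : Prop :=
  Finite N.I ∧ ∀ i, Finite (N.J i)

/-- The disjunctive unfolding: the transformation pairs `tp_{C_i}` on the objects `C_i = N.obj i`
with matches `o₁ ≫ a i` and `o₂ ≫ a i`, for those `i` for which `a i` satisfies the gluing
conditions of the derived spans (i.e. is an extension morphism). For each `i` this pair is unique
up to isomorphism. -/
def disjunctiveUnfolding (N : RegularForm E x) : Set (PairFor ρ₁ ρ₂) :=
  {y | ∃ (i : N.I) (tp : TransformationPair ρ₁.toPlainRule ρ₂.toPlainRule (N.obj i)),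
    y = ⟨N.obj i, tp⟩ ∧
    tp.fst.o = x.2.fst.o ≫ N.a i ∧ tp.snd.o = x.2.snd.o ≫ N.a i ∧
    Nonempty (PairExtension (N.a i) x.2 tp)}

end RegularForm

end PairFor

end MAdh

/-! `Shift` turns satisfaction into satisfaction after composition (`sat_shift`), and `Left`
transports it across a double pushout (`sat_left`). Hence, when a pair on `K` extends along `m`, the
morphism `m` satisfies `ac_K ∧ ac*_K` exactly if the extended pair is a conflict
(`sat_iff_isConflict`).

Completeness: some initial conflict embeds into each conflict via some `f`, namely the initial pair
or, for plainly independent pairs, the coproduct pair (`exists_initialConflict`). As `f` satisfies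
the regular form, `f = a_i ≫ q` with `q` in `M`. Restricting the conflict along `q` gives a member
of the disjunctive unfolding. Conversely, such members are conflicts because the identity of `C_i`
satisfies the negative remainder.

Regular forms: for NACs, `ac*_K` is a disjunction of conditions `∃ a_i`, and shifting `ac_K` along
`a_i` gives NACs over `C_i` (`exists_regularForm`). A disjunct having an isomorphism among its NACs
is unsatisfiable and is dropped. For finiteness, representatives of `E`-pairs serve as indices. The
object of an initial conflict is in `F` because every `M`-subobject through which both matches
factor is the whole object (`of_isInitialConflict`). -/

namespace MAdh

/-! ### Pushouts and pushout complements along `M` -/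

section Categories

variable {C : Type u} [Category.{v} C] {M : MorphismProperty C}

lemma isPullback_id_of_mono {W X Y : C} {f : W ⟶ X} {p : X ⟶ Y} {g : W ⟶ Y} [Mono p]
    (h : f ≫ p = g) : IsPullback f (𝟙 W) p g :=
  IsPullback.of_vert_isIso_mono ⟨by simpa using h⟩

lemma isIso_of_mono_of_section {X Y : C} (m : X ⟶ Y) [Mono m] (s : Y ⟶ X) (h : s ≫ m = 𝟙 Y) :
    IsIso m :=
  ⟨s, by rw [← cancel_mono m]; simp [h], h⟩

namespace IsMAdhesive

variable (hM : IsMAdhesive M)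
include hM

lemma id_mem (X : C) : M (𝟙 X) := hM.of_isIso _ inferInstance

/-- The van Kampen property is applied to the cube over `sq` with vertical morphisms `𝟙 W`, `f`, `𝟙
Y`, `i`. Its top is trivially a pushout, and one of its front faces is the square itself. -/
lemma isPullback {W X Y Z : C} {f : W ⟶ X} {g : W ⟶ Y} {h : X ⟶ Z} {i : Y ⟶ Z}
    (sq : IsPushout f g h i) (hf : M f) : IsPullback f g h i := by
  have := hM.mono f hf
  exact ((hM.vanKampen sq hf (𝟙 W) g g (𝟙 Y) (𝟙 W) f (𝟙 Y) i hf (hM.id_mem Y)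
    (hM.pushout_mem sq hf) (isPullback_id_of_mono (Category.id_comp f))
    IsPullback.of_id_snd ⟨sq.w.symm⟩ ⟨by simp⟩ ⟨by simp⟩).1 IsPushout.of_id_fst).1.flip

/-- Pulling `s` back along `r₁'` gives a pushout whose leg at `I` is `𝟙 I`; `p₁` is the opposite
side, hence invertible. -/
lemma isIso_snd_of_pushoutComplements {I R Z Z₁ X U : C} {r : I ⟶ R} {z : I ⟶ Z} {a : R ⟶ X}
    {r' : Z ⟶ X} {z₁ : I ⟶ Z₁} {r₁' : Z₁ ⟶ X} (hr : M r) (s : IsPushout r z a r')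
    (s₁ : IsPushout r z₁ a r₁') {p : U ⟶ Z} {p₁ : U ⟶ Z₁} (hU : IsPullback p p₁ r' r₁') :
    IsIso p₁ := by
  have := hM.mono r hr
  have hr₁' := hM.pushout_mem s₁ hr
  have hp : M p := hM.pullback_mem hU.flip hr₁'
  have := hM.mono p hp
  have hw : r ≫ a = z ≫ r' := s.w
  have hw₁ : r ≫ a = z₁ ≫ r₁' := s₁.w
  have po := (hM.vanKampen s hr (𝟙 I) (hU.lift z z₁ (hw.symm.trans hw₁)) z₁ p₁ (𝟙 I) r p r₁'
    hr hp hr₁' (isPullback_id_of_mono (Category.id_comp r))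
    (isPullback_id_of_mono (hU.lift_fst _ _ _)) ⟨hw₁.symm⟩ ⟨hU.w.symm⟩ ⟨by simp⟩).2
    ⟨(hM.isPullback s₁ hr).flip, hU.flip⟩
  exact po.isIso_inr_of_isIso

/-- Pushout complements along `M`-morphisms are unique up to isomorphism. -/
lemma exists_iso_of_pushoutComplements {I R Z Z₁ X : C} {r : I ⟶ R} {z : I ⟶ Z} {a : R ⟶ X}
    {r' : Z ⟶ X} {z₁ : I ⟶ Z₁} {r₁' : Z₁ ⟶ X} (hr : M r) (s : IsPushout r z a r')
    (s₁ : IsPushout r z₁ a r₁') : ∃ φ : Z ≅ Z₁, z ≫ φ.hom = z₁ ∧ φ.hom ≫ r₁' = r' := by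
  have hr' := hM.pushout_mem s hr
  have hr₁' := hM.pushout_mem s₁ hr
  have := hM.mono _ hr₁'
  have := hM.hasPullback r' r₁' hr'
  have hU := IsPullback.of_hasPullback r' r₁'
  have := hM.isIso_snd_of_pushoutComplements hr s s₁ hU
  have := hM.isIso_snd_of_pushoutComplements hr s₁ s hU.flip
  have key : (inv (pullback.fst r' r₁') ≫ pullback.snd r' r₁') ≫ r₁' = r' := by
    rw [Category.assoc, ← pullback.condition, IsIso.inv_hom_id_assoc]
  refine ⟨asIso (inv (pullback.fst r' r₁') ≫ pullback.snd r' r₁'), ?_, key⟩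
  rw [← cancel_mono r₁', asIso_hom, Category.assoc, key, ← s.w, s₁.w]

/-- Pullback of a pushout along an `M`-morphism into its corner object. -/
lemma isPushout_of_isPullback {I R D H X Z : C} {r : I ⟶ R} {z : I ⟶ D} {a : R ⟶ X}
    {q : X ⟶ H} {c : D ⟶ H} (hr : M r) (hq : M q) (s : IsPushout r z (a ≫ q) c)
    {r' : Z ⟶ X} {d : Z ⟶ D} (hZ : IsPullback r' d q c) :
    ∃ z' : I ⟶ Z, z' ≫ d = z ∧ IsPushout r z' a r' ∧ IsPushout r' d q c := by
  have := hM.mono q hq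
  have hd := hM.pullback_mem hZ hq
  have := hM.mono d hd
  have hw : (r ≫ a) ≫ q = z ≫ c := by simpa using s.w
  have hz : hZ.lift (r ≫ a) z hw ≫ d = z := hZ.lift_snd _ _ _
  have hz' : hZ.lift (r ≫ a) z hw ≫ r' = r ≫ a := hZ.lift_fst _ _ _
  -- The comatch factors through `q`, so pulling `s` back along `q` leaves `R` and `I` unchanged.
  have po : IsPushout r (hZ.lift (r ≫ a) z hw) a r' :=
    (hM.vanKampen s hr r (hZ.lift (r ≫ a) z hw) a r' (𝟙 I) (𝟙 R) d q (hM.id_mem R) hd hq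
      IsPullback.of_id_snd (isPullback_id_of_mono hz) ⟨by simp⟩ ⟨hZ.w⟩ ⟨hz'.symm⟩).2
      ⟨isPullback_id_of_mono rfl, hZ⟩
  refine ⟨_, hz, po, IsPushout.of_top (v₁₁ := hZ.lift (r ≫ a) z hw) ?_ hZ.w po⟩
  rwa [hz]

/-- Pulling `s` back along `q` produces one pushout complement of `r` and `a`; by uniqueness it can
be replaced by the given one. -/
lemma exists_factor_of_pushoutComplement {I R D H X Z : C} {r : I ⟶ R} {z : I ⟶ D} {a : R ⟶ X}
    {q : X ⟶ H} {c : D ⟶ H} {z₁ : I ⟶ Z} {r₁ : Z ⟶ X} (hr : M r) (hq : M q)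
    (s : IsPushout r z (a ≫ q) c) (s₁ : IsPushout r z₁ a r₁) :
    ∃ d : Z ⟶ D, M d ∧ z₁ ≫ d = z ∧ IsPushout r₁ d q c := by
  have := hM.hasPullback q c hq
  have hZ := IsPullback.of_hasPullback q c
  obtain ⟨z', hz', s', t⟩ := hM.isPushout_of_isPullback hr hq s hZ
  obtain ⟨φ, h₁, h₂⟩ := hM.exists_iso_of_pushoutComplements hr s₁ s'
  refine ⟨φ.hom ≫ pullback.snd q c, hM.comp _ _ (hM.of_isIso _ inferInstance)
    (hM.pullback_mem hZ hq), by rw [reassoc_of% h₁, hz'], ?_⟩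
  exact IsPushout.of_iso' t φ (Iso.refl _) (Iso.refl _) (Iso.refl _) (by simp [h₂]) (by simp)
    (by simp) (by simp)

end IsMAdhesive

end Categories

/-! ### Semantics of `Shift` and `Left` -/

namespace AppCond

variable {C : Type u} [Category.{v} C] {M : MorphismProperty C} {E : PairClass C}

@[simp] lemma sat_ex {P Q G : C} (a : P ⟶ Q) (c : AppCond Q) (p : P ⟶ G) :
    (ex a c).Sat M p ↔ ∃ q, M q ∧ a ≫ q = p ∧ c.Sat M q := by rw [Sat]

@[simp] lemma sat_neg {P G : C} (c : AppCond P) (p : P ⟶ G) :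
    (neg c).Sat M p ↔ ¬ c.Sat M p := by rw [Sat]

@[simp] lemma sat_conj {P G : C} (J : Type (max u v)) (c : J → AppCond P) (p : P ⟶ G) :
    (conj J c).Sat M p ↔ ∀ j, (c j).Sat M p := by rw [Sat]

@[simp] lemma sat_truth {P G : C} (p : P ⟶ G) : (truth : AppCond P).Sat M p := by
  simp [truth]

@[simp] lemma not_sat_falsity {P G : C} (p : P ⟶ G) : ¬ (falsity : AppCond P).Sat M p := by
  simp [falsity]

@[simp] lemma sat_and {P G : C} (c d : AppCond P) (p : P ⟶ G) :
    (c.and d).Sat M p ↔ c.Sat M p ∧ d.Sat M p := by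
  simp [AppCond.and, and_comm]

@[simp] lemma sat_disj {P G : C} (J : Type (max u v)) (c : J → AppCond P) (p : P ⟶ G) :
    (disj J c).Sat M p ↔ ∃ j, (c j).Sat M p := by
  simp [disj]

@[simp] lemma sat_nacs {P G : C} {J : Type (max u v)} {N : J → C} (n : ∀ j, P ⟶ N j)
    (p : P ⟶ G) : (nacs n).Sat M p ↔ ∀ j, ¬ ∃ q, M q ∧ n j ≫ q = p := by
  simp [nacs]

/-- Satisfaction of a condition shifted along `b` is satisfaction after composing with `b`. -/
lemma sat_shift (hM : IsMAdhesive M) (hE : HasUniquePairFactorization E M) {P : C}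
    (c : AppCond P) : ∀ {P' : C} (b : P ⟶ P') {G : C} (p : P' ⟶ G),
      (c.shift E M b).Sat M p ↔ c.Sat M (b ≫ p) := by
  induction c with
  | ex a c ih =>
    intro P' b G p
    rw [shift, sat_disj, sat_ex]
    constructor
    · rintro ⟨x, hx⟩
      obtain ⟨q, hq, hp, hc⟩ := (sat_ex _ _ _).1 hx
      refine ⟨x.b' ≫ q, hM.comp _ _ x.mem hq, ?_, (ih _ _).1 hc⟩
      rw [← hp, ← Category.assoc, x.comm, Category.assoc]
    · rintro ⟨q, hq, hp, hc⟩
      -- The `E`-part of the factorization of `(p, q)` is the required index, the `M`-part the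
      -- required witness.
      obtain ⟨X, a', b', m, he, hm, h₁, h₂⟩ := hE.exists_fac p q
      have := hM.mono m hm
      refine ⟨⟨X, a', b', he, hM.decomp b' m (h₂ ▸ hq) hm, ?_⟩, ?_⟩
      · rw [← cancel_mono m, Category.assoc, Category.assoc, h₁, h₂, hp]
      · exact (sat_ex _ _ _).2 ⟨m, hm, h₁, (ih _ _).2 (h₂ ▸ hc)⟩
  | neg c ih =>
    intro P' b G p
    rw [shift, sat_neg, sat_neg, ih]
  | conj J c ih =>
    intro P' b G p
    rw [shift, sat_conj, sat_conj]
    exact forall_congr' fun j => ih j b p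

/-- For a direct transformation, the match satisfies `Left(c)` iff the comatch satisfies `c`. -/
lemma sat_left (hM : IsMAdhesive M) {R : C} (c : AppCond R) :
    ∀ {L I G D H : C} {l : I ⟶ L} {r : I ⟶ R} {z : I ⟶ D} {o : L ⟶ G} {k : D ⟶ G}
      {o' : R ⟶ H} {c' : D ⟶ H}, M l → M r → IsPushout l z o k → IsPushout r z o' c' →
      ((c.left l r).Sat M o ↔ c.Sat M o') := by
  induction c with
  | ex a c ih =>
    intro L I G D H l r z o k o' c' hl hr s t
    rw [left, sat_ex]
    constructor
    · intro hx
      split_ifs at hx with h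
      · generalize h.some = y at hx
        obtain ⟨q, hq, rfl, hc⟩ := (sat_ex _ _ _).1 hx
        obtain ⟨d, hd, hz, s'⟩ := hM.exists_factor_of_pushoutComplement hl hq s y.left_po
        subst hz
        have hw : r ≫ o' = y.z ≫ d ≫ c' := by simpa using t.w
        have ha := y.right_po.inl_desc o' (d ≫ c') hw
        have t' : IsPushout y.r' d (y.right_po.desc o' (d ≫ c') hw) c' :=
          IsPushout.of_top (by rwa [ha]) (y.right_po.inr_desc _ _ _) y.right_po
        exact ⟨_, hM.pushout_mem t'.flip hd, ha,
          (ih (hM.pushout_mem y.left_po hl) (hM.pushout_mem y.right_po hr) s' t').1 hc⟩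
      · exact absurd hx (not_sat_falsity _)
    · rintro ⟨q, hq, rfl, hc⟩
      -- The pushout complement exists because that of `o'` can be pulled back along `q`.
      have h : Nonempty (LeftStep l r a) := by
        have := hM.hasPullback q c' hq
        obtain ⟨z', -, s', -⟩ :=
          hM.isPushout_of_isPullback hr hq t (IsPullback.of_hasPullback q c')
        have := hM.hasPushout l z' hl
        exact ⟨⟨_, _, z', _, _, _, s', IsPushout.of_hasPushout l z'⟩⟩
      rw [dif_pos h]
      generalize h.some = y
      obtain ⟨d, hd, hz, t'⟩ := hM.exists_factor_of_pushoutComplement hr hq t y.right_po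
      subst hz
      have hw : l ≫ o = y.z ≫ d ≫ k := by simpa using s.w
      have ha := y.left_po.inl_desc o (d ≫ k) hw
      have s' : IsPushout y.l' d (y.left_po.desc o (d ≫ k) hw) k :=
        IsPushout.of_top (by rwa [ha]) (y.left_po.inr_desc _ _ _) y.left_po
      exact (sat_ex _ _ _).2 ⟨_, hM.pushout_mem s'.flip hd, ha,
        (ih (hM.pushout_mem y.left_po hl) (hM.pushout_mem y.right_po hr) s' t').2 hc⟩
  | neg c ih =>
    intro L I G D H l r z o k o' c' hl hr s t
    rw [left, sat_neg, sat_neg, ih hl hr s t]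
  | conj J c ih =>
    intro L I G D H l r z o k o' c' hl hr s t
    rw [left, sat_conj, sat_conj]
    exact forall_congr' fun j => ih j hl hr s t

end AppCond

/-! ### Extension diagrams: composition, restriction, lifting -/

section Transformations

variable {C : Type u} [Category.{v} C] {M : MorphismProperty C}

namespace DirectTransformation

variable {p : PlainRule M} {G : C} (t : DirectTransformation p G)

lemma k_mem (hM : IsMAdhesive M) : M t.k := hM.pushout_mem t.left_po p.l_mem

lemma c_mem (hM : IsMAdhesive M) : M t.c := hM.pushout_mem t.right_po p.r_mem

end DirectTransformation

namespace Extension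

variable {p : PlainRule M} {G G' G'' : C} {t : DirectTransformation p G}
  {t' : DirectTransformation p G'} {t'' : DirectTransformation p G''}

/-- An extension diagram is determined by its part between the context objects. -/
noncomputable def ofContext {f : G ⟶ G'} (d : t.D ⟶ t'.D) (ho : t.o ≫ f = t'.o)
    (hu : t.u ≫ d = t'.u) (hk : t.k ≫ f = d ≫ t'.k) : Extension f t t' :=
  have hw : p.r ≫ t'.o' = t.u ≫ d ≫ t'.c := by
    rw [t'.right_po.w, ← hu, Category.assoc]
  { d := d
    h := t.right_po.desc t'.o' (d ≫ t'.c) hw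
    o_comp := ho
    u_comp := hu
    o'_comp := t.right_po.inl_desc _ _ _
    left_po := IsPushout.of_top (by rw [ho, hu]; exact t'.left_po) hk t.left_po
    right_po := IsPushout.of_top (by rw [IsPushout.inl_desc, hu]; exact t'.right_po)
      (t.right_po.inr_desc _ _ _) t.right_po }

/-- The identity extension diagram. -/
def refl (t : DirectTransformation p G) : Extension (𝟙 G) t t where
  d := 𝟙 _
  h := 𝟙 _
  o_comp := Category.comp_id _
  u_comp := Category.comp_id _
  o'_comp := Category.comp_id _
  left_po := IsPushout.of_id_snd
  right_po := IsPushout.of_id_snd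

/-- Composition of extension diagrams. -/
def comp {f : G ⟶ G'} {g : G' ⟶ G''} (e : Extension f t t') (e' : Extension g t' t'') :
    Extension (f ≫ g) t t'' where
  d := e.d ≫ e'.d
  h := e.h ≫ e'.h
  o_comp := by rw [← Category.assoc, e.o_comp, e'.o_comp]
  u_comp := by rw [← Category.assoc, e.u_comp, e'.u_comp]
  o'_comp := by rw [← Category.assoc, e.o'_comp, e'.o'_comp]
  left_po := e.left_po.paste_vert e'.left_po
  right_po := e.right_po.paste_vert e'.right_po

/-- A direct transformation restricts along every `M`-morphism through which its match factors. -/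
lemma exists_restriction (hM : IsMAdhesive M) (t' : DirectTransformation p G') (m : G ⟶ G')
    (hm : M m) (o : p.L ⟶ G) (ho : o ≫ m = t'.o) :
    ∃ t : DirectTransformation p G, t.o = o ∧ Nonempty (Extension m t t') := by
  have := hM.hasPullback m t'.k hm
  have hZ := IsPullback.of_hasPullback m t'.k
  obtain ⟨z, hz, s, -⟩ :=
    hM.isPushout_of_isPullback p.l_mem hm (by rw [ho]; exact t'.left_po) hZ
  have := hM.hasPushout p.r z p.r_mem
  exact ⟨⟨_, _, o, z, _, _, _, s, IsPushout.of_hasPushout p.r z⟩, rfl,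
    ⟨ofContext (pullback.snd m t'.k) ho hz pullback.condition⟩⟩

/-- The left square of `e'` is also a pullback, so the context morphism over `fg` factors through
the middle context. -/
lemma lift (hM : IsMAdhesive M) {f : G ⟶ G'} {g : G' ⟶ G''} {fg : G ⟶ G''} (h : f ≫ g = fg)
    (e : Extension fg t t'') (e' : Extension g t' t'') (ho : t.o ≫ f = t'.o) :
    Nonempty (Extension f t t') := by
  have := hM.mono _ (t'.k_mem hM)
  have pb := hM.isPullback e'.left_po (t'.k_mem hM)
  have hw : (t.k ≫ f) ≫ g = e.d ≫ t''.k := by rw [Category.assoc, h, e.left_po.w]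
  have hk := pb.lift_fst _ _ hw
  refine ⟨ofContext (pb.lift (t.k ≫ f) e.d hw) ho ?_ hk.symm⟩
  rw [← cancel_mono t'.k, Category.assoc, hk, ← Category.assoc, ← t.left_po.w, Category.assoc, ho,
    t'.left_po.w]

end Extension

namespace PairExtension

variable {p₁ p₂ : PlainRule M} {G G' G'' : C} {t : TransformationPair p₁ p₂ G}
  {t' : TransformationPair p₁ p₂ G'} {t'' : TransformationPair p₁ p₂ G''}

/-- The identity extension diagrams of a pair. -/
def refl (t : TransformationPair p₁ p₂ G) : PairExtension (𝟙 G) t t :=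
  ⟨Extension.refl _, Extension.refl _⟩

/-- Composition of extension diagrams of pairs. -/
def comp {f : G ⟶ G'} {g : G' ⟶ G''} (e : PairExtension f t t') (e' : PairExtension g t' t'') :
    PairExtension (f ≫ g) t t'' :=
  ⟨e.fst.comp e'.fst, e.snd.comp e'.snd⟩

lemma exists_restriction (hM : IsMAdhesive M) (t' : TransformationPair p₁ p₂ G') (m : G ⟶ G')
    (hm : M m) (o₁ : p₁.L ⟶ G) (o₂ : p₂.L ⟶ G) (h₁ : o₁ ≫ m = t'.fst.o)
    (h₂ : o₂ ≫ m = t'.snd.o) :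
    ∃ t : TransformationPair p₁ p₂ G, t.fst.o = o₁ ∧ t.snd.o = o₂ ∧
      Nonempty (PairExtension m t t') := by
  obtain ⟨s₁, hs₁, ⟨e₁⟩⟩ := Extension.exists_restriction hM t'.fst m hm o₁ h₁
  obtain ⟨s₂, hs₂, ⟨e₂⟩⟩ := Extension.exists_restriction hM t'.snd m hm o₂ h₂
  exact ⟨⟨s₁, s₂⟩, hs₁, hs₂, ⟨⟨e₁, e₂⟩⟩⟩

lemma lift (hM : IsMAdhesive M) {f : G ⟶ G'} {g : G' ⟶ G''} {fg : G ⟶ G''} (h : f ≫ g = fg)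
    (e : PairExtension fg t t'') (e' : PairExtension g t' t'') (h₁ : t.fst.o ≫ f = t'.fst.o)
    (h₂ : t.snd.o ≫ f = t'.snd.o) : Nonempty (PairExtension f t t') := by
  obtain ⟨e₁⟩ := Extension.lift hM h e.fst e'.fst h₁
  obtain ⟨e₂⟩ := Extension.lift hM h e.snd e'.snd h₂
  exact ⟨⟨e₁, e₂⟩⟩

end PairExtension

end Transformations

end MAdh

/-! ### Conflicts as satisfaction of the symbolic conditions -/

namespace MAdh

variable {C : Type u} [Category.{v} C] {M : MorphismProperty C} {E : PairClass C}

/-- The left square of an extension is a pullback. So if a match does not factor through the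
context, neither does its extension. -/
lemma Extension.exists_context_lift (hM : IsMAdhesive M) {p : PlainRule M} {G G' L : C}
    {t : DirectTransformation p G} {t' : DirectTransformation p G'} {f : G ⟶ G'}
    (e : Extension f t t') (o : L ⟶ G) (d' : L ⟶ t'.D) (h : d' ≫ t'.k = o ≫ f) :
    ∃ d : L ⟶ t.D, d ≫ t.k = o ∧ d ≫ e.d = d' := by
  have pb := hM.isPullback e.left_po (t.k_mem hM)
  exact ⟨pb.lift o d' h.symm, pb.lift_fst _ _ _, pb.lift_snd _ _ _⟩

open Classical in
/-- The condition on `G` stating that `o` factors through the context of `t` and that `ac` holds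
after `t`. -/
noncomputable def DirectTransformation.residualAC (E : PairClass C) {p : PlainRule M} {G L : C}
    (t : DirectTransformation p G) (o : L ⟶ G) (ac : AppCond L) : AppCond G :=
  if h : ∃ d : L ⟶ t.D, d ≫ t.k = o then (ac.shift E M (h.choose ≫ t.c)).left t.k t.c
  else AppCond.falsity

lemma Extension.sat_residualAC (hM : IsMAdhesive M) (hE : HasUniquePairFactorization E M)
    {p : PlainRule M} {G G' L : C} {t : DirectTransformation p G} {t' : DirectTransformation p G'}
    {f : G ⟶ G'} (e : Extension f t t') (o : L ⟶ G) (ac : AppCond L) :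
    (t.residualAC E o ac).Sat M f ↔
      ∃ d' : L ⟶ t'.D, d' ≫ t'.k = o ≫ f ∧ ac.Sat M (d' ≫ t'.c) := by
  have := hM.mono _ (t.k_mem hM)
  have := hM.mono _ (t'.k_mem hM)
  unfold DirectTransformation.residualAC
  split_ifs with h
  · have hd := h.choose_spec
    generalize h.choose = d at hd
    subst hd
    rw [AppCond.sat_left hM _ (t.k_mem hM) (t.c_mem hM) e.left_po e.right_po,
      AppCond.sat_shift hM hE]
    have hc : (d ≫ t.c) ≫ e.h = (d ≫ e.d) ≫ t'.c := by simp [e.right_po.w]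
    have hk : (d ≫ e.d) ≫ t'.k = (d ≫ t.k) ≫ f := by simp [e.left_po.w]
    rw [hc]
    constructor
    · exact fun hac => ⟨_, hk, hac⟩
    · rintro ⟨d', hd', hac⟩
      -- As `t'.k` is mono, the factorization is unique, so the choice of `d` is harmless.
      rw [← hk, cancel_mono] at hd'
      exact hd' ▸ hac
  · refine iff_of_false (AppCond.not_sat_falsity _) ?_
    rintro ⟨d', hd', -⟩
    obtain ⟨d, hd, -⟩ := e.exists_context_lift hM o d' hd'
    exact h ⟨d, hd⟩

namespace PairFor

variable {ρ₁ ρ₂ : Rule M}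

lemma conflictAC_eq (x : PairFor ρ₁ ρ₂) :
    x.conflictAC E = AppCond.neg ((x.2.snd.residualAC E x.2.fst.o ρ₁.ac).and
      (x.2.fst.residualAC E x.2.snd.o ρ₂.ac)) := rfl

lemma sat_extAC (hM : IsMAdhesive M) (hE : HasUniquePairFactorization E M) (x : PairFor ρ₁ ρ₂)
    {G : C} (p : x.1 ⟶ G) :
    (x.extAC E).Sat M p ↔ ρ₁.ac.Sat M (x.2.fst.o ≫ p) ∧ ρ₂.ac.Sat M (x.2.snd.o ≫ p) := by
  rw [extAC, AppCond.sat_and, AppCond.sat_shift hM hE, AppCond.sat_shift hM hE]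

/-- An extension morphism of `x` satisfies the conditions of the symbolic pair of `x` iff the
extended pair is a conflict. -/
lemma sat_iff_isConflict (hM : IsMAdhesive M) (hE : HasUniquePairFactorization E M)
    {x y : PairFor ρ₁ ρ₂} {m : x.1 ⟶ y.1} (e : PairExtension m x.2 y.2) :
    ((x.extAC E).and (x.conflictAC E)).Sat M m ↔ y.IsConflict := by
  rw [AppCond.sat_and, sat_extAC hM hE, conflictAC_eq, AppCond.sat_neg, AppCond.sat_and,
    e.snd.sat_residualAC hM hE, e.fst.sat_residualAC hM hE, e.fst.o_comp, e.snd.o_comp]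
  rfl

end PairFor

/-! ### Initial pairs -/

namespace TransformationPair

variable {p₁ p₂ : PlainRule M} {G G' GI : C}

/-- Used contrapositively: whatever embeds into a plainly dependent pair is plainly dependent. -/
lemma PlainIndependent.of_extension {tp : TransformationPair p₁ p₂ G}
    {tp' : TransformationPair p₁ p₂ G'} {f : G ⟶ G'} (h : tp.PlainIndependent)
    (e : PairExtension f tp tp') : tp'.PlainIndependent := by
  obtain ⟨⟨d₁₂, h₁⟩, ⟨d₂₁, h₂⟩⟩ := h
  exact ⟨⟨d₁₂ ≫ e.snd.d, by rw [Category.assoc, ← e.snd.left_po.w, reassoc_of% h₁, e.fst.o_comp]⟩,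
    ⟨d₂₁ ≫ e.fst.d, by rw [Category.assoc, ← e.fst.left_po.w, reassoc_of% h₂, e.snd.o_comp]⟩⟩

lemma isomorphic_refl (tp : TransformationPair p₁ p₂ G) : tp.Isomorphic tp :=
  ⟨𝟙 G, PairExtension.refl tp, inferInstance, inferInstanceAs (IsIso (𝟙 _)),
    inferInstanceAs (IsIso (𝟙 _)), inferInstanceAs (IsIso (𝟙 _)), inferInstanceAs (IsIso (𝟙 _))⟩

/-- An initial pair is initial for itself. -/
lemma IsInitialFor.self {tpI : TransformationPair p₁ p₂ GI} {tp : TransformationPair p₁ p₂ G}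
    (h : tpI.IsInitialFor tp) : tpI.IsInitialFor tpI := by
  obtain ⟨fI, ⟨eI⟩, hI⟩ := h
  refine ⟨𝟙 GI, ⟨PairExtension.refl _⟩, fun G' tp' f ⟨e⟩ => ?_⟩
  obtain ⟨s, hs, -⟩ := hI GI tpI fI ⟨eI⟩
  -- Embeddings into `tpI` become embeddings into `tp` via `fI`; uniqueness there forces `w.1 ≫ f`
  -- to be the identity.
  obtain ⟨w, hw, huw⟩ := hI G' tp' (f ≫ fI) ⟨e.comp eI⟩
  refine ⟨w, ?_, fun w' hw' => huw w' ?_⟩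
  · have hu := hI GI tpI fI ⟨eI⟩
    have := hu.unique (y₁ := ⟨w.1 ≫ f, w.2.comp e⟩) (y₂ := ⟨𝟙 GI, PairExtension.refl _⟩)
      (by simpa using hw) (Category.id_comp _)
    exact congrArg Sigma.fst this
  · change w'.1 ≫ f ≫ fI = fI
    rw [reassoc_of% hw']

/-- If `tp` is isomorphic to an initial pair for it, then some isomorphism factors through every
morphism along which a pair embeds into `tp`. -/
lemma IsInitialFor.exists_isIso {tpI : TransformationPair p₁ p₂ GI}
    {tp : TransformationPair p₁ p₂ G} (h : tpI.IsInitialFor tp) (hi : tp.Isomorphic tpI) :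
    ∃ fI : GI ⟶ G, IsIso fI ∧ ∀ (G' : C) (tp' : TransformationPair p₁ p₂ G') (f : G' ⟶ G),
      Nonempty (PairExtension f tp' tp) → ∃ g : GI ⟶ G', g ≫ f = fI := by
  obtain ⟨fI, ⟨eI⟩, hI⟩ := h
  refine ⟨fI, ?_, fun G' tp' f e => ?_⟩
  · obtain ⟨φ, eφ, hφ, -⟩ := hi
    have endo : ∀ g : GI ⟶ GI, PairExtension g tpI tpI → g ≫ fI = fI → g = 𝟙 GI := fun g eg hg =>
      congrArg Sigma.fst ((hI GI tpI fI ⟨eI⟩).unique (y₁ := ⟨g, eg⟩)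
        (y₂ := ⟨𝟙 GI, PairExtension.refl _⟩) hg (Category.id_comp _))
    -- Initiality against the embedding `fI ≫ φ ≫ fI` yields a two-sided inverse of `fI ≫ φ`.
    obtain ⟨w, hw, -⟩ := hI GI tpI (fI ≫ φ ≫ fI) ⟨eI.comp (eφ.comp eI)⟩
    have h₁ : w.1 ≫ fI ≫ φ = 𝟙 GI := endo _ (w.2.comp (eI.comp eφ)) (by simpa using hw)
    have h₂ : (fI ≫ φ) ≫ w.1 = 𝟙 GI := by
      refine endo _ ((eI.comp eφ).comp w.2) ?_
      rw [← cancel_mono φ]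
      simp only [Category.assoc, h₁, Category.comp_id]
    have : IsIso (fI ≫ φ) := ⟨w.1, h₂, h₁⟩
    exact IsIso.of_isIso_comp_right fI φ
  · obtain ⟨w, hw, -⟩ := hI G' tp' f e
    exact ⟨w.1, hw⟩

end TransformationPair

/-! ### Disjunctive unfoldings and completeness -/

namespace PairFor

variable {ρ₁ ρ₂ : Rule M}

/-- The identity satisfies each `¬ ∃ (b, d)`: if `b ≫ q = 𝟙` with `q` in `M`, then `q` is a split
epic mono, so `q` and `b` are isomorphisms. -/
lemma mem_disjunctiveUnfolding_isConflict (hM : IsMAdhesive M)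
    (hE : HasUniquePairFactorization E M) {x : PairFor ρ₁ ρ₂} (N : RegularForm E x)
    {y : PairFor ρ₁ ρ₂} (hy : y ∈ N.disjunctiveUnfolding) : y.IsConflict := by
  obtain ⟨i, tp, rfl, -, -, ⟨e⟩⟩ := hy
  rw [← sat_iff_isConflict hM hE e, N.equiv, AppCond.sat_disj]
  refine ⟨i, (AppCond.sat_ex _ _ _).2 ⟨𝟙 _, hM.id_mem _, Category.comp_id _, ?_⟩⟩
  rw [AppCond.sat_conj]
  intro j
  rw [AppCond.sat_neg, AppCond.sat_ex]
  rintro ⟨q, hq, h, -⟩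
  have := hM.mono q hq
  have hbq : IsIso q := isIso_of_mono_of_section q _ h
  exact N.not_isIso i j ((IsIso.eq_inv_of_inv_hom_id (f := q) h) ▸ inferInstance)

/-- If `x` embeds into the conflict `y`, then some element of its disjunctive unfolding embeds into
`y` via an `M`-morphism. -/
lemma exists_mem_disjunctiveUnfolding (hM : IsMAdhesive M)
    (hE : HasUniquePairFactorization E M) {x : PairFor ρ₁ ρ₂} (N : RegularForm E x)
    {y : PairFor ρ₁ ρ₂} (hy : y.IsConflict) {f : x.1 ⟶ y.1} (e : PairExtension f x.2 y.2) :
    ∃ z ∈ N.disjunctiveUnfolding, ∃ m : z.1 ⟶ y.1, M m ∧ Nonempty (PairExtension m z.2 y.2) := by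
  rw [← sat_iff_isConflict hM hE e, N.equiv, AppCond.sat_disj] at hy
  obtain ⟨i, hi⟩ := hy
  obtain ⟨q, hq, hf, -⟩ := (AppCond.sat_ex _ _ _).1 hi
  obtain ⟨t, h₁, h₂, ⟨e'⟩⟩ := PairExtension.exists_restriction hM y.2 q hq
    (x.2.fst.o ≫ N.a i) (x.2.snd.o ≫ N.a i)
    (by rw [Category.assoc, hf, e.fst.o_comp]) (by rw [Category.assoc, hf, e.snd.o_comp])
  exact ⟨⟨N.obj i, t⟩, ⟨i, t, rfl, h₁, h₂, PairExtension.lift hM hf e e' h₁.symm h₂.symm⟩,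
    q, hq, ⟨e'⟩⟩

lemma IsConflict.conflictInducing {x y : PairFor ρ₁ ρ₂} (hy : y.IsConflict) {f : x.1 ⟶ y.1}
    (e : PairExtension f x.2 y.2) : x.ConflictInducing :=
  ⟨y, ⟨hy.1, f, ⟨e⟩⟩, hy⟩

/-- Every plain independent pair is an extension of the pair on the coproduct. -/
lemma exists_extension_coproductPair [HasBinaryCoproducts C] {p₁ p₂ : PlainRule M} {G : C}
    {tp : TransformationPair p₁ p₂ G} (h : tp.PlainIndependent) :
    Nonempty (PairExtension (coprod.desc tp.fst.o tp.snd.o) (coproductPair p₁ p₂) tp) := by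
  obtain ⟨⟨d₁₂, h₁⟩, ⟨d₂₁, h₂⟩⟩ := h
  -- Independence supplies exactly the missing components `d₂₁`, `d₁₂` of the context morphisms out
  -- of `I₁ + L₂` and `L₁ + I₂`.
  refine ⟨⟨Extension.ofContext (coprod.desc tp.fst.u d₂₁) (coprod.inl_desc _ _)
    (coprod.inl_desc _ _) ?_, Extension.ofContext (coprod.desc d₁₂ tp.snd.u) (coprod.inr_desc _ _)
    (coprod.inr_desc _ _) ?_⟩⟩
  · change coprod.map p₁.l (𝟙 _) ≫ coprod.desc _ _ = coprod.desc _ _ ≫ tp.fst.k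
    rw [coprod.map_desc, coprod.desc_comp, h₂, tp.fst.left_po.w, Category.id_comp]
  · change coprod.map (𝟙 _) p₂.l ≫ coprod.desc _ _ = coprod.desc _ _ ≫ tp.snd.k
    rw [coprod.map_desc, coprod.desc_comp, h₁, tp.snd.left_po.w, Category.id_comp]

lemma coproductPair_plainIndependent [HasBinaryCoproducts C] (p₁ p₂ : PlainRule M) :
    (coproductPair p₁ p₂).PlainIndependent :=
  ⟨⟨coprod.inl, by change coprod.inl ≫ coprod.map (𝟙 _) p₂.l = coprod.inl; simp⟩,
    ⟨coprod.inr, by change coprod.inr ≫ coprod.map p₁.l (𝟙 _) = coprod.inr; simp⟩⟩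

/-- Some initial conflict embeds into every conflict. -/
lemma exists_initialConflict [HasBinaryCoproducts C]
    (h : ∀ (G : C) (tp : TransformationPair ρ₁.toPlainRule ρ₂.toPlainRule G),
      ¬ tp.PlainIndependent → ∃ (GI : C)
        (tpI : TransformationPair ρ₁.toPlainRule ρ₂.toPlainRule GI), tpI.IsInitialFor tp)
    {y : PairFor ρ₁ ρ₂} (hy : y.IsConflict) :
    ∃ x : PairFor ρ₁ ρ₂, x.IsInitialConflict ∧
      ∃ f : x.1 ⟶ y.1, Nonempty (PairExtension f x.2 y.2) := by
  by_cases hp : y.2.PlainIndependent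
  · obtain ⟨e⟩ := exists_extension_coproductPair hp
    exact ⟨⟨_, coproductPair ρ₁.toPlainRule ρ₂.toPlainRule⟩, ⟨hy.conflictInducing e,
      Or.inr ⟨coproductPair_plainIndependent _ _, TransformationPair.isomorphic_refl _⟩⟩, _, ⟨e⟩⟩
  · obtain ⟨GI, tpI, hI⟩ := h _ _ hp
    obtain ⟨f, ⟨e⟩, -⟩ := id hI
    exact ⟨⟨GI, tpI⟩, ⟨IsConflict.conflictInducing (x := ⟨GI, tpI⟩) hy e,
      Or.inl ⟨fun hi => hp (hi.of_extension e), GI, tpI, hI.self,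
        TransformationPair.isomorphic_refl _⟩⟩, f, ⟨e⟩⟩

end PairFor

/-! ### Size bounds for objects -/

/-- `F` is closed under `M`-subobjects, and two objects of `F` are the domains of a set of pairs of
`E` up to isomorphism, with codomain in `F`; if `φ` holds then this set is finite. -/
structure IsPairBounded (E : PairClass C) (M : MorphismProperty C) (F : C → Prop) (φ : Prop) :
    Prop where
  of_mem : ∀ {A B : C} (m : A ⟶ B), M m → F B → F A
  exists_pairs : ∀ A B : C, F A → F B →
    ∃ (T : Type (max u v)) (X : T → C) (e₁ : ∀ i, A ⟶ X i) (e₂ : ∀ i, B ⟶ X i),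
      (φ → Finite T) ∧ (∀ i, F (X i)) ∧ (∀ i, E (e₁ i) (e₂ i)) ∧
      ∀ (Y : C) (f₁ : A ⟶ Y) (f₂ : B ⟶ Y), E f₁ f₂ →
        ∃ (i : T) (ψ : X i ≅ Y), e₁ i ≫ ψ.hom = f₁ ∧ e₂ i ≫ ψ.hom = f₂

/-- With all objects allowed and `φ` false, the construction of regular forms also covers the case
without finiteness. -/
lemma isPairBounded_true (E : PairClass C) (M : MorphismProperty C) :
    IsPairBounded E M (fun _ => True) False where
  of_mem _ _ _ := trivial
  exists_pairs A B _ _ := ⟨Σ X : C, {e : (A ⟶ X) × (B ⟶ X) // E e.1 e.2}, fun i => i.1,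
    fun i => i.2.1.1, fun i => i.2.1.2, False.elim, fun _ => trivial, fun i => i.2.2,
    fun Y f₁ f₂ h => ⟨⟨Y, (f₁, f₂), h⟩, Iso.refl Y, Category.comp_id _, Category.comp_id _⟩⟩

/-- `E` is not assumed closed under isomorphism, so listed pairs need not lie in `E`. Those
isomorphic to no pair of `E` are dropped, the others replaced by an isomorphic one in `E`. -/
lemma IsFinitaryClass.isPairBounded (hM : IsMAdhesive M) {F : C → Prop}
    (hF : IsFinitaryClass E M F) : IsPairBounded E M F True where
  of_mem := hF.of_mem
  exists_pairs A B hA hB := by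
    obtain ⟨n, X, e₁, e₂, hX, h⟩ := hF.finite_pairs A B hA hB
    let T := {i : Fin n // ∃ (Y : C) (ψ : X i ≅ Y), E (e₁ i ≫ ψ.hom) (e₂ i ≫ ψ.hom)}
    choose Y ψ hY using fun i : T => i.2
    refine ⟨ULift T, fun i => Y i.down, fun i => e₁ i.down.1 ≫ (ψ i.down).hom,
      fun i => e₂ i.down.1 ≫ (ψ i.down).hom, fun _ => inferInstance,
      fun i => hF.of_mem (ψ i.down).inv (hM.of_isIso _ inferInstance) (hX _), fun i => hY i.down,
      fun Z f₁ f₂ hZ => ?_⟩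
    obtain ⟨i, χ, rfl, rfl⟩ := h Z f₁ f₂ hZ
    exact ⟨⟨⟨i, Z, χ, hZ⟩⟩, (ψ ⟨i, Z, χ, hZ⟩).symm ≪≫ χ, by simp, by simp⟩

section Closure

variable {F : C → Prop} {φ : Prop}

namespace IsPairBounded

variable (hF : IsPairBounded E M F φ)
include hF

lemma of_iso (hM : IsMAdhesive M) {A B : C} (ψ : A ≅ B) (hB : F B) : F A :=
  hF.of_mem ψ.hom (hM.of_isIso _ inferInstance) hB

lemma codomain_mem (hM : IsMAdhesive M) {A B X : C} {e₁ : A ⟶ X} {e₂ : B ⟶ X} (h : E e₁ e₂)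
    (hA : F A) (hB : F B) : F X := by
  obtain ⟨T, Y, _, _, _, hY, _, hc⟩ := hF.exists_pairs A B hA hB
  obtain ⟨i, ψ, -⟩ := hc _ _ _ h
  exact hF.of_iso hM ψ.symm (hY i)

/-- If all `M`-morphisms through which `f` and `g` factor are split epimorphisms, then the common
codomain of `f` and `g` is in `F` along with the domains. -/
lemma of_sections (hM : IsMAdhesive M) (hE : HasUniquePairFactorization E M) {A B X : C}
    (f : A ⟶ X) (g : B ⟶ X) (hA : F A) (hB : F B)
    (h : ∀ (K : C) (m : K ⟶ X) (e₁ : A ⟶ K) (e₂ : B ⟶ K), M m → e₁ ≫ m = f → e₂ ≫ m = g →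
      ∃ s : X ⟶ K, s ≫ m = 𝟙 X) : F X := by
  obtain ⟨K, e₁, e₂, m, he, hm, h₁, h₂⟩ := hE.exists_fac f g
  obtain ⟨s, hs⟩ := h K m e₁ e₂ hm h₁ h₂
  have := hM.mono m hm
  have := isIso_of_mono_of_section m s hs
  exact hF.of_iso hM (asIso m).symm (hF.codomain_mem hM he hA hB)

/-- A cocone that factors through an `M`-subobject induces a section of it. -/
lemma of_isPushout (hM : IsMAdhesive M) (hE : HasUniquePairFactorization E M) {W X Y Z : C}
    {f : W ⟶ X} {g : W ⟶ Y} {h : X ⟶ Z} {i : Y ⟶ Z} (s : IsPushout f g h i) (hX : F X)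
    (hY : F Y) : F Z := by
  refine hF.of_sections hM hE h i hX hY fun K m e₁ e₂ hm h₁ h₂ => ?_
  have := hM.mono m hm
  have hw : f ≫ e₁ = g ≫ e₂ := by
    rw [← cancel_mono m, Category.assoc, Category.assoc, h₁, h₂, s.w]
  exact ⟨s.desc e₁ e₂ hw, s.hom_ext (by simp [h₁]) (by simp [h₂])⟩

/-- If both matches factor through an `M`-subobject, the pair restricts to it and initiality gives a
section. For the coproduct pair, the universal property does. -/
lemma of_isInitialConflict [HasBinaryCoproducts C] (hM : IsMAdhesive M)
    (hE : HasUniquePairFactorization E M) {ρ₁ ρ₂ : Rule M} {x : PairFor ρ₁ ρ₂}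
    (hx : x.IsInitialConflict) (h₁ : F ρ₁.L) (h₂ : F ρ₂.L) : F x.1 := by
  obtain ⟨-, ⟨-, GI, tpI, hI, hi⟩ | ⟨-, f, -, hf, -⟩⟩ := hx
  · obtain ⟨fI, hfI, hg⟩ := hI.exists_isIso hi
    refine hF.of_sections hM hE x.2.fst.o x.2.snd.o h₁ h₂ fun K m e₁ e₂ hm he₁ he₂ => ?_
    obtain ⟨t, -, -, e⟩ := PairExtension.exists_restriction hM x.2 m hm e₁ e₂ he₁ he₂
    obtain ⟨g, hg⟩ := hg K t m e
    exact ⟨inv fI ≫ g, by rw [Category.assoc, hg, IsIso.inv_hom_id]⟩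
  · refine hF.of_iso hM (asIso f) (hF.of_sections hM hE coprod.inl coprod.inr h₁ h₂
      fun K m e₁ e₂ hm he₁ he₂ => ⟨coprod.desc e₁ e₂, ?_⟩)
    exact coprod.hom_ext (by rw [coprod.inl_desc_assoc, he₁, Category.comp_id])
      (by rw [coprod.inr_desc_assoc, he₂, Category.comp_id])

end IsPairBounded

end Closure

/-! ### Families of existential conditions and regular forms -/

/-- A family of morphisms out of `P` with codomains in `F`, finite if `φ` holds. -/
structure MorphismFamily (F : C → Prop) (φ : Prop) (P : C) where
  I : Type (max u v)
  obj : I → C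
  a : ∀ i, P ⟶ obj i
  mem : ∀ i, F (obj i)
  finite : φ → Finite I

namespace MorphismFamily

variable {F : C → Prop} {φ : Prop}

/-- `p` satisfies the disjunction of the conditions `∃ (a i)`. -/
def Covers (M : MorphismProperty C) {P : C} (A : MorphismFamily F φ P) {G : C} (p : P ⟶ G) : Prop :=
  ∃ (i : A.I) (q : A.obj i ⟶ G), M q ∧ A.a i ≫ q = p

/-- The union of families indexed by `J`. -/
def union {P : C} {J : Type (max u v)} (hJ : φ → Finite J) (A : J → MorphismFamily F φ P) :
    MorphismFamily F φ P where
  I := Σ j, (A j).I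
  obj i := (A i.1).obj i.2
  a i := (A i.1).a i.2
  mem i := (A i.1).mem i.2
  finite h := by
    have := hJ h
    have := fun j => (A j).finite h
    infer_instance

lemma covers_union {P : C} {J : Type (max u v)} (hJ : φ → Finite J)
    (A : J → MorphismFamily F φ P) {G : C} (p : P ⟶ G) :
    (union hJ A).Covers M p ↔ ∃ j, (A j).Covers M p :=
  ⟨fun ⟨⟨j, i⟩, q, hq⟩ => ⟨j, i, q, hq⟩, fun ⟨j, i, q, hq⟩ => ⟨⟨j, i⟩, q, hq⟩⟩

/-- The union of two families. -/
def sup {P : C} (A B : MorphismFamily F φ P) : MorphismFamily F φ P :=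
  union (J := ULift Bool) (fun _ => inferInstance) (fun j => cond j.down A B)

lemma covers_sup {P : C} (A B : MorphismFamily F φ P) {G : C} (p : P ⟶ G) :
    (A.sup B).Covers M p ↔ A.Covers M p ∨ B.Covers M p := by
  simp [sup, covers_union, or_comm]

end MorphismFamily

/-- Makes the arbitrary choice in `left` irrelevant up to isomorphism. -/
lemma AppCond.LeftStep.exists_iso (hM : IsMAdhesive M) {L I R X : C} {l : I ⟶ L} {r : I ⟶ R}
    {a : R ⟶ X} (hr : M r) (s t : LeftStep l r a) : ∃ θ : s.Y ≅ t.Y, s.b ≫ θ.hom = t.b := by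
  obtain ⟨ψ, h, -⟩ := hM.exists_iso_of_pushoutComplements hr s.right_po t.right_po
  have po : IsPushout l s.z t.b (ψ.hom ≫ t.l') :=
    IsPushout.of_iso' t.left_po (Iso.refl _) (Iso.refl _) ψ (Iso.refl _) (by simp) (by simp [h])
      (by simp) (by simp)
  exact ⟨s.left_po.isoIsPushout _ _ po, s.left_po.inl_isoIsPushout_hom _ _ po⟩

/-- Transport of the data of `Left` along an isomorphism of codomains. -/
def AppCond.LeftStep.ofIso {L I R X X' : C} {l : I ⟶ L} {r : I ⟶ R} {a : R ⟶ X} {a' : R ⟶ X'}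
    (s : LeftStep l r a) (ψ : X' ≅ X) (h : a' ≫ ψ.hom = a) : LeftStep l r a' where
  Z := s.Z
  Y := s.Y
  z := s.z
  r' := s.r' ≫ ψ.inv
  b := s.b
  l' := s.l'
  right_po := IsPushout.of_iso' s.right_po (Iso.refl _) (Iso.refl _) (Iso.refl _) ψ (by simp)
    (by simp) (by simp [h]) (by simp)
  left_po := s.left_po

lemma AppCond.sat_left_shift_nacs {D K P L : C} {k : D ⟶ K} {c : D ⟶ P} (b : L ⟶ P)
    {J : Type (max u v)} {N : J → C} (n : ∀ j, L ⟶ N j) {G : C} (p : K ⟶ G) :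
    (((AppCond.nacs n).shift E M b).left k c).Sat M p ↔
      ∀ j, ¬ ∃ (x : AppCond.ShiftIndex E M (n j) b)
        (h : Nonempty (AppCond.LeftStep k c x.a')) (q : h.some.Y ⟶ G), M q ∧ h.some.b ≫ q = p := by
  simp only [AppCond.nacs, AppCond.truth, AppCond.shift, AppCond.disj, AppCond.left,
    AppCond.sat_conj, AppCond.sat_neg, not_forall, not_not]
  refine forall_congr' fun j => not_congr (exists_congr fun x => ?_)
  split_ifs with h
  · simp [h]
  · simp [h]

namespace IsPairBounded

variable {F : C → Prop} {φ : Prop} (hF : IsPairBounded E M F φ) (hM : IsMAdhesive M)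
  (hE : HasUniquePairFactorization E M)
include hF hM hE

/-- The first components of `E`-pairs with both domains `P` suffice, by factoring `(p, p)`. The
single condition `∃ (𝟙 P)` would only cover `p` in `M`. -/
lemma exists_family_true {P : C} (hP : F P) :
    ∃ A : MorphismFamily F φ P, ∀ (G : C) (p : P ⟶ G), A.Covers M p := by
  obtain ⟨T, X, e₁, e₂, hT, hX, -, hc⟩ := hF.exists_pairs P P hP hP
  refine ⟨⟨T, X, e₁, hX, hT⟩, fun G p => ?_⟩
  obtain ⟨K, f₁, f₂, m, he, hm, h₁, -⟩ := hE.exists_fac p p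
  obtain ⟨i, ψ, rfl, -⟩ := hc K f₁ f₂ he
  exact ⟨i, ψ.hom ≫ m, hM.comp _ _ (hM.of_isIso _ inferInstance) hm, by rw [← h₁, Category.assoc]⟩

/-- Representatives of `E`-pairs replace the full `ShiftIndex`, so the family can be finite. -/
lemma exists_family_shift {P P' N : C} (b : P ⟶ P') (n : P ⟶ N) (hP : F P') (hN : F N) :
    ∃ A : MorphismFamily F φ P', ∀ (G : C) (p : P' ⟶ G),
      A.Covers M p ↔ ∃ q, M q ∧ n ≫ q = b ≫ p := by
  obtain ⟨T, X, e₁, e₂, hT, hX, -, hc⟩ := hF.exists_pairs P' N hP hN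
  refine ⟨⟨{i : T // M (e₂ i) ∧ n ≫ e₂ i = b ≫ e₁ i}, fun i => X i, fun i => e₁ i,
    fun i => hX i, fun h => have := hT h; inferInstance⟩, fun G p => ⟨?_, ?_⟩⟩
  · rintro ⟨⟨i, hi, hw⟩, q, hq, rfl⟩
    exact ⟨e₂ i ≫ q, hM.comp _ _ hi hq, by simpa using congrArg (· ≫ q) hw⟩
  · rintro ⟨q, hq, hw⟩
    obtain ⟨K, f₁, f₂, m, he, hm, rfl, rfl⟩ := hE.exists_fac p q
    obtain ⟨i, ψ, rfl, rfl⟩ := hc K f₁ f₂ he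
    have hψ : M (ψ.hom ≫ m) := hM.comp _ _ (hM.of_isIso _ inferInstance) hm
    have := hM.mono _ hψ
    refine ⟨⟨i, hM.decomp _ (ψ.hom ≫ m) (by simpa using hq) hψ, ?_⟩, ψ.hom ≫ m, hψ, by simp⟩
    rw [← cancel_mono (ψ.hom ≫ m)]
    simpa using hw

lemma exists_family_left {D K P L N : C} {k : D ⟶ K} {c : D ⟶ P} (hc : M c) (b : L ⟶ P)
    (n : L ⟶ N) (hK : F K) (hP : F P) (hN : F N) :
    ∃ A : MorphismFamily F φ K, ∀ (G : C) (p : K ⟶ G), A.Covers M p ↔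
      ∃ (x : AppCond.ShiftIndex E M n b) (h : Nonempty (AppCond.LeftStep k c x.a'))
        (q : h.some.Y ⟶ G), M q ∧ h.some.b ≫ q = p := by
  obtain ⟨T, X, e₁, e₂, hT, hX, he, hcov⟩ := hF.exists_pairs P N hP hN
  refine ⟨⟨{i : T // (M (e₂ i) ∧ n ≫ e₂ i = b ≫ e₁ i) ∧ Nonempty (AppCond.LeftStep k c (e₁ i))},
    -- The codomain is a pushout of `K` and an `M`-subobject of `X i`, hence in `F`.
    fun i => i.2.2.some.Y, fun i => i.2.2.some.b, fun i => hF.of_isPushout hM hE i.2.2.some.left_po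
      hK (hF.of_mem _ (hM.pushout_mem i.2.2.some.right_po hc) (hX i)),
    fun h => have := hT h; inferInstance⟩, fun G p => ⟨?_, ?_⟩⟩
  · rintro ⟨⟨i, ⟨hi, hw⟩, h⟩, q, hq⟩
    exact ⟨⟨X i, e₁ i, e₂ i, he i, hi, hw⟩, h, q, hq⟩
  · rintro ⟨⟨Y, a', b', hab, hb', hw⟩, h, q, hq, rfl⟩
    obtain ⟨i, ψ, rfl, rfl⟩ := hcov Y a' b' hab
    have h' : Nonempty (AppCond.LeftStep k c (e₁ i)) := ⟨h.some.ofIso ψ rfl⟩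
    obtain ⟨θ, hθ⟩ := AppCond.LeftStep.exists_iso hM hc h'.some (h.some.ofIso ψ rfl)
    refine ⟨⟨i, ⟨hM.decomp _ ψ.hom hb' (hM.of_isIso _ inferInstance), ?_⟩, h'⟩, θ.hom ≫ q,
      hM.comp _ _ (hM.of_isIso _ inferInstance) hq, ?_⟩
    · rw [← cancel_mono ψ.hom]
      simpa using hw
    · exact (Category.assoc _ _ _).symm.trans (congrArg (· ≫ q) hθ)

/-- The negated residual condition of a conjunction of negative conditions is positive. -/
lemma exists_family_residualAC {p : PlainRule M} {K L : C} (t : DirectTransformation p K)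
    (o : L ⟶ K) {J : Type (max u v)} (hJ : φ → Finite J) {N : J → C} (n : ∀ j, L ⟶ N j)
    (hK : F K) (hR : F p.R) (hN : ∀ j, F (N j)) :
    ∃ A : MorphismFamily F φ K, ∀ (G : C) (q : K ⟶ G),
      A.Covers M q ↔ ¬ (t.residualAC E o (AppCond.nacs n)).Sat M q := by
  unfold DirectTransformation.residualAC
  split_ifs with h
  · have hH : F t.H := hF.of_isPushout hM hE t.right_po hR (hF.of_mem _ (t.k_mem hM) hK)
    choose A hA using fun j => hF.exists_family_left hM hE (k := t.k) (t.c_mem hM)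
      (h.choose ≫ t.c) (n j) hK hH (hN j)
    refine ⟨MorphismFamily.union hJ A, fun G q => ?_⟩
    rw [MorphismFamily.covers_union, AppCond.sat_left_shift_nacs, not_forall]
    exact exists_congr fun j => by rw [hA, not_not]
  -- Without a factorization the residual condition is false, so its negation must be covered by a
  -- family for `true`.
  · obtain ⟨A, hA⟩ := hF.exists_family_true hM hE hK
    exact ⟨A, fun G q => iff_of_true (hA G q) (AppCond.not_sat_falsity _)⟩

lemma exists_family_nacs {P L : C} (b : L ⟶ P) {J : Type (max u v)} (hJ : φ → Finite J)
    {N : J → C} (n : ∀ j, L ⟶ N j) (hP : F P) (hN : ∀ j, F (N j)) :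
    ∃ A : MorphismFamily F φ P, ∀ (G : C) (q : P ⟶ G),
      A.Covers M q ↔ ¬ (AppCond.nacs n).Sat M (b ≫ q) := by
  choose A hA using fun j => hF.exists_family_shift hM hE b (n j) hP (hN j)
  refine ⟨MorphismFamily.union hJ A, fun G q => ?_⟩
  rw [MorphismFamily.covers_union, AppCond.sat_nacs, not_forall]
  exact exists_congr fun j => by rw [hA, not_not]

/-- Conflict-inducing symbolic pairs of rules with conjunctions of negative conditions have regular
forms with plain negative remainders. -/
lemma exists_regularForm {ρ₁ ρ₂ : Rule M} {J₁ J₂ : Type (max u v)} (hJ₁ : φ → Finite J₁)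
    (hJ₂ : φ → Finite J₂) {N₁ : J₁ → C} {N₂ : J₂ → C} (n₁ : ∀ j, ρ₁.L ⟶ N₁ j)
    (n₂ : ∀ j, ρ₂.L ⟶ N₂ j) (h₁ : ρ₁.ac = AppCond.nacs n₁) (h₂ : ρ₂.ac = AppCond.nacs n₂)
    (hR₁ : F ρ₁.R) (hR₂ : F ρ₂.R) (hN₁ : ∀ j, F (N₁ j)) (hN₂ : ∀ j, F (N₂ j))
    (x : PairFor ρ₁ ρ₂) (hK : F x.1) (hx : x.ConflictInducing) :
    ∃ N : PairFor.RegularForm E x, N.OnlyNACs ∧ (φ → N.IsFinite) := by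
  obtain ⟨A₁, hA₁⟩ := hF.exists_family_residualAC hM hE x.2.snd x.2.fst.o hJ₁ n₁ hK hR₂ hN₁
  obtain ⟨A₂, hA₂⟩ := hF.exists_family_residualAC hM hE x.2.fst x.2.snd.o hJ₂ n₂ hK hR₁ hN₂
  obtain ⟨A, hA⟩ : ∃ A : MorphismFamily F φ x.1, ∀ (G : C) (p : x.1 ⟶ G),
      (x.conflictAC E).Sat M p ↔ A.Covers M p := by
    refine ⟨A₁.sup A₂, fun G p => ?_⟩
    rw [MorphismFamily.covers_sup, hA₁, hA₂, PairFor.conflictAC_eq, AppCond.sat_neg,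
      AppCond.sat_and, not_and_or, h₁, h₂]
  -- The extension condition is moved inside each disjunct by shifting it along `A.a i`.
  choose B₁ hB₁ using fun i => hF.exists_family_nacs hM hE (x.2.fst.o ≫ A.a i) hJ₁ n₁ (A.mem i) hN₁
  choose B₂ hB₂ using fun i => hF.exists_family_nacs hM hE (x.2.snd.o ≫ A.a i) hJ₂ n₂ (A.mem i) hN₂
  let B := fun i => (B₁ i).sup (B₂ i)
  have hB : ∀ (i : A.I) (G : C) (q : A.obj i ⟶ G),
      (x.extAC E).Sat M (A.a i ≫ q) ↔ ¬ (B i).Covers M q := by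
    intro i G q
    rw [MorphismFamily.covers_sup, hB₁, hB₂, PairFor.sat_extAC hM hE, ← not_and_or, not_not, h₁, h₂,
      Category.assoc, Category.assoc]
  let I := {i : A.I // ∀ j, ¬ IsIso ((B i).a j)}
  have key : ∀ (G : C) (p : x.1 ⟶ G), ((x.extAC E).and (x.conflictAC E)).Sat M p ↔
      ∃ (i : I) (q : A.obj i ⟶ G), M q ∧ A.a i ≫ q = p ∧ ¬ (B i).Covers M q := by
    intro G p
    rw [AppCond.sat_and, hA]
    constructor
    · rintro ⟨hp, i, q, hq, rfl⟩
      have hn := (hB i G q).1 hp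
      -- An invertible member of `B i` would cover every `q` in `M`, so dropping such `i` loses
      -- nothing.
      refine ⟨⟨i, fun j hj => hn ⟨j, inv ((B i).a j) ≫ q, ?_, by simp⟩⟩, q, hq, rfl, hn⟩
      exact hM.comp _ _ (hM.of_isIso _ inferInstance) hq
    · rintro ⟨i, q, hq, rfl, hn⟩
      exact ⟨(hB i G q).2 hn, i, q, hq, rfl⟩
  have hI : Nonempty I := by
    obtain ⟨y, ⟨-, m, ⟨e⟩⟩, hy⟩ := hx
    obtain ⟨i, -⟩ := (key _ _).1 ((PairFor.sat_iff_isConflict hM hE e).2 hy)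
    exact ⟨i⟩
  refine ⟨⟨I, hI, fun i => A.obj i, fun i => A.a i, fun i => (B i).I, fun i => (B i).obj,
    fun i => (B i).a, fun _ _ => AppCond.truth, fun i => i.2, fun G p => ?_⟩,
    fun _ _ => rfl, fun h => ⟨?_, fun i => (B i).finite h⟩⟩
  · rw [key, AppCond.sat_disj]
    refine exists_congr fun i => ?_
    simp [MorphismFamily.Covers]
  · have := A.finite h
    exact inferInstanceAs (Finite I)

end IsPairBounded

end MAdh

theorem mainTheorem8
    {C : Type u} [Category.{v} C] [HasBinaryCoproducts C]
    (M : MorphismProperty C) (hM : MAdh.IsMAdhesive M)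
    (E : MAdh.PairClass C) (hE : MAdh.HasUniquePairFactorization E M)
    (𝓡 : Set (MAdh.Rule M)) (h𝓡 : MAdh.HasInitialPairsForConflicts 𝓡)
    (ρ₁ ρ₂ : MAdh.Rule M) (hρ₁ : ρ₁ ∈ 𝓡) (hρ₂ : ρ₂ ∈ 𝓡)
    (J₁ J₂ : Type (max u v)) [Finite J₁] [Finite J₂]
    (N₁ : J₁ → C) (N₂ : J₂ → C) (n₁ : ∀ j, ρ₁.L ⟶ N₁ j) (n₂ : ∀ j, ρ₂.L ⟶ N₂ j)
    (h₁ : ρ₁.ac = MAdh.AppCond.nacs n₁) (h₂ : ρ₂.ac = MAdh.AppCond.nacs n₂) :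
    -- every initial conflict is regular, so that the disjunctive unfoldings are defined
    (∀ x : MAdh.PairFor ρ₁ ρ₂, x.IsInitialConflict →
      ∃ N : MAdh.PairFor.RegularForm E x, N.OnlyNACs) ∧
    -- with finite index sets, if the objects of the two rules are finite
    (∀ F : C → Prop, MAdh.IsFinitaryClass E M F →
      F ρ₁.L → F ρ₁.R → F ρ₂.L → F ρ₂.R → (∀ j, F (N₁ j)) → (∀ j, F (N₂ j)) →
      ∀ x : MAdh.PairFor ρ₁ ρ₂, x.IsInitialConflict →
        ∃ N : MAdh.PairFor.RegularForm E x, N.OnlyNACs ∧ N.IsFinite) ∧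
    -- the union of the disjunctive unfoldings is an `M`-complete set of conflicts
    (∀ N : ∀ x : MAdh.PairFor ρ₁ ρ₂, x.IsInitialConflict → MAdh.PairFor.RegularForm E x,
      (∀ y ∈ ⋃ (x : MAdh.PairFor ρ₁ ρ₂) (hx : x.IsInitialConflict),
        (N x hx).disjunctiveUnfolding, y.IsConflict) ∧
      MAdh.PairFor.MComplete (⋃ (x : MAdh.PairFor ρ₁ ρ₂) (hx : x.IsInitialConflict),
        (N x hx).disjunctiveUnfolding)) := by
  refine ⟨fun x hx => ?_, fun F hF hL₁ hR₁ hL₂ hR₂ hN₁ hN₂ x hx => ?_, fun N => ⟨?_, ?_⟩⟩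
  · obtain ⟨N, hN, -⟩ := (MAdh.isPairBounded_true E M).exists_regularForm hM hE (fun _ => ‹_›)
      (fun _ => ‹_›) n₁ n₂ h₁ h₂ trivial trivial (fun _ => trivial) (fun _ => trivial) x trivial hx.1
    exact ⟨N, hN⟩
  · have hF' := hF.isPairBounded hM
    obtain ⟨N, hN, hf⟩ := hF'.exists_regularForm hM hE (fun _ => ‹_›) (fun _ => ‹_›) n₁ n₂ h₁ h₂
      hR₁ hR₂ hN₁ hN₂ x (hF'.of_isInitialConflict hM hE hx hL₁ hL₂) hx.1
    exact ⟨N, hN, hf trivial⟩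
  · intro y hy
    simp only [Set.mem_iUnion] at hy
    obtain ⟨x, hx, hy⟩ := hy
    exact MAdh.PairFor.mem_disjunctiveUnfolding_isConflict hM hE _ hy
  · intro y hy
    obtain ⟨x, hx, f, ⟨e⟩⟩ := MAdh.PairFor.exists_initialConflict (h𝓡 ρ₁ hρ₁ ρ₂ hρ₂) hy
    obtain ⟨z, hz, m, hm⟩ :=
      MAdh.PairFor.exists_mem_disjunctiveUnfolding hM hE (N x hx) hy e
    exact ⟨z, Set.mem_iUnion₂.2 ⟨x, hx, hz⟩, m, hm⟩
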